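/- Let $d\ge 1$, $\mathcal X=[0,1]^d$, and let $\alpha,c_0,C_0,c_0',C_0'>0$. For $M>0$ let $\Sigma^\alpha(M)$ be the Hölder class on all of $\mathcal X$ (the case $\kappa=\infty$): with $k=\lfloor\alpha\rfloor$, the set of $f:\mathcal X\to\mathbb R$ that are $k$ times differentiable on $\mathcal X$ and satisfy, for all $x,x'\in\mathcal X$, $$\sum_{j=0}^{k}\ \sum_{\alpha_1+\dots+\alpha_d=j}\bigl|\partial^{(\alpha_1,\dots,\alpha_d)}f(x)\bigr|+\sum_{\alpha_1+\dots+\alpha_d=k}\frac{\bigl|\partial^{(\alpha_1,\dots,\alpha_d)}f(x)-\partial^{(\alpha_1,\dots,\alpha_d)}f(x')\bigr|}{\|x-x'\|_\infty^{\alpha-k}}\le M$$ (the second sum being read as $0$ when $x=x'$). For bounded $f:\mathcal X\to\mathbb R$ put $f^*=\inf_{\mathcal X}f$, $\mathfrak L(x;f)=f(x)-f^*$, $L_f(\epsilon)=\{x\in\mathcal X: f(x)\le f^*+\epsilon\}$ and $\mu_f(\epsilon)=\lambda(L_f(\epsilon))$, where $\lambda$ is Lebesgue measure. Consider the following two conditions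 on a function $f_0$: (A2) for all $\epsilon,\delta\in(0,c_0]$, the smallest number of Euclidean balls of radius $\delta$ that cover $L_{f_0}(\epsilon)$ is at most $C_0\,[1+\mu_{f_0}(\epsilon)\,\delta^{-d}]$; (A2') for all $\epsilon,\delta\in(0,c_0']$, the largest number of pairwise disjoint closed Euclidean balls of radius $\delta$ contained in $L_{f_0}(\epsilon)$ is at least $C_0'\,\mu_{f_0}(\epsilon)\,\delta^{-d}$. For $n\ge1$ put $$\varepsilon_n^{\mathsf L}(f_0)=\sup\bigl\{\varepsilon>0:\ \varepsilon^{-(2+d/\alpha)}\mu_{f_0}(\varepsilon)\ge n\bigr\}.$$ An active optimization algorithm with $n$ queries consists of measurable maps $\chi_t:(x_1,y_1,\dots,x_{t-1},y_{t-1},U)\mapsto x_t\in\mathcal X$ for $1\le t\le n$ and $\phi_n:(x_1,y_1,\dots,x_n,y_n,U)\mapsto\hat x_n\in\mathcal X$, where $U$ is a random element of an arbitrary probability space. Under $\Pr_f$ the observations are $y_t=f(x_t)+w_t$, with $w_1,\dots,w_n$ i.i.d. $\mathcal N(0,1)$ and independent of $U$. **Theorem.** There is a constant $M>0$ depending only on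 $\alpha,d,c_0,C_0,c_0',C_0'$ such that, for every $f_0\in\Sigma^\alpha(M/2)$ satisfying (A2) and (A2'), every $n\ge1$ and every active optimization algorithm with $n$ queries (which may depend on $f_0$), there is $f\in\Sigma^\alpha(M)$ with $\|f-f_0\|_\infty\le 2\varepsilon_n^{\mathsf L}(f_0)$ and $$\Pr_f\bigl[\mathfrak L(\hat x_n;f)\ge\varepsilon_n^{\mathsf L}(f_0)\bigr]\ge\tfrac13 .$$ In particular, $$\inf_{\hat x_n}\ \sup_{\substack{f\in\Sigma^\alpha(M),\\ \|f-f_0\|_\infty\le 2\varepsilon_n^{\mathsf L}(f_0)}}\Pr_f\bigl[\mathfrak L(\hat x_n;f)\ge\varepsilon_n^{\mathsf L}(f_0)\bigr]\ge\tfrac13 .$$ -/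

import Mathlib

open MeasureTheory ProbabilityTheory
open scoped NNReal ENNReal

namespace ZerothOrder

noncomputable section

/-- `ℝ^d` with the Euclidean norm. -/
abbrev Pt (d : ℕ) : Type := EuclideanSpace ℝ (Fin d)

/-- The domain `[0,1]^d`. -/
def cube (d : ℕ) : Set (Pt d) := {x | ∀ i, x i ∈ Set.Icc (0 : ℝ) 1}

/-- The sup norm `max_i |x_i|`. -/
def supNorm {d : ℕ} (x : Pt d) : ℝ := ‖(WithLp.ofLp x : Fin d → ℝ)‖

/-- The word `0 … 0 1 … 1 … (d-1) … (d-1)` in which the letter `i` occurs `a i` times. -/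
def multiIndexWord {d : ℕ} (a : Fin d → ℕ) : List (Fin d) :=
  (List.finRange d).flatMap fun i => List.replicate (a i) i

/-- The partial derivative `∂^{|a|} f / ∂x_1^{a_1} … ∂x_d^{a_d}` on the cube
(one-sided at the boundary). -/
def partialDeriv {d : ℕ} (f : Pt d → ℝ) (a : Fin d → ℕ) (x : Pt d) : ℝ :=
  iteratedFDerivWithin ℝ (multiIndexWord a).length f (cube d) x
    fun m => EuclideanSpace.single ((multiIndexWord a).get m) (1 : ℝ)

/-- The multi-indices in `ℕ^d` of order `j`. -/
def multiIndices (d j : ℕ) : Finset (Fin d → ℕ) := Finset.piAntidiag Finset.univ j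

/-- `f` is `k` times (Fréchet) differentiable on the cube. -/
def DifferentiableTimesOnCube {d : ℕ} (k : ℕ) (f : Pt d → ℝ) : Prop :=
  ∀ j < k, DifferentiableOn ℝ (iteratedFDerivWithin ℝ j f (cube d)) (cube d)

/-- The Hölder class `Σ^α(M)` on the whole cube (the case `κ = ∞`). -/
def HolderClass (d : ℕ) (α M : ℝ) : Set (Pt d → ℝ) :=
  {f | DifferentiableTimesOnCube ⌊α⌋₊ f ∧
    ∀ x ∈ cube d, ∀ x' ∈ cube d,
      (∑ j ∈ Finset.range (⌊α⌋₊ + 1), ∑ a ∈ multiIndices d j, |partialDeriv f a x|)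
        + ∑ a ∈ multiIndices d ⌊α⌋₊,
            |partialDeriv f a x - partialDeriv f a x'| / supNorm (x - x') ^ (α - (⌊α⌋₊ : ℝ))
        ≤ M}

/-- The global minimum `f^*`, the infimum of `f` over the cube. -/
def minValue {d : ℕ} (f : Pt d → ℝ) : ℝ := sInf (f '' cube d)

/-- The optimization error `f(x) - f^*`. -/
def optError {d : ℕ} (f : Pt d → ℝ) (x : Pt d) : ℝ := f x - minValue f

/-- The level set `L_f(ε)`. -/
def levelSet {d : ℕ} (f : Pt d → ℝ) (ε : ℝ) : Set (Pt d) :=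
  {x | x ∈ cube d ∧ f x ≤ minValue f + ε}

/-- The distribution function `μ_f(ε)`, the Lebesgue measure of the level set. -/
def levelVolume {d : ℕ} (f : Pt d → ℝ) (ε : ℝ) : ℝ := (volume (levelSet f ε)).toReal

/-- The largest number of pairwise disjoint closed Euclidean balls of radius `δ` that are
contained in `A`. -/
def ballPackingNumber {d : ℕ} (A : Set (Pt d)) (δ : ℝ) : ℕ∞ :=
  ⨆ (s : Finset (Pt d)) (_ : (∀ x ∈ s, Metric.closedBall x δ ⊆ A) ∧
    (s : Set (Pt d)).PairwiseDisjoint fun x => Metric.closedBall x δ), (s.card : ℕ∞)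

/-- The class `Θ_C` of functions with regular level sets, `C = (c₀, C₀)`. The covering number
counts closed Euclidean balls of radius `δ` with arbitrary centres. -/
def RegularLevelSets (d : ℕ) (c₀ C₀ : ℝ) : Set (Pt d → ℝ) :=
  {f | ∀ ε ∈ Set.Ioc 0 c₀, ∀ δ ∈ Set.Ioc 0 c₀,
    ((Metric.externalCoveringNumber δ.toNNReal (levelSet f ε) : ℕ∞) : ℝ≥0∞)
      ≤ ENNReal.ofReal (C₀ * (1 + levelVolume f ε * (δ ^ d)⁻¹))}

/-- The class `Θ'_{C'}`, `C' = (c₀', C₀')`, defined by the reverse condition on packings. -/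
def PackedLevelSets (d : ℕ) (c₀' C₀' : ℝ) : Set (Pt d → ℝ) :=
  {f | ∀ ε ∈ Set.Ioc 0 c₀', ∀ δ ∈ Set.Ioc 0 c₀',
    ENNReal.ofReal (C₀' * levelVolume f ε * (δ ^ d)⁻¹)
      ≤ ((ballPackingNumber (levelSet f ε) δ : ℕ∞) : ℝ≥0∞)}

/-- The local rate `sup {ε > 0 : ε^{-(2+d/α)} μ_f(ε) ≥ n}`. -/
def lowerRate {d : ℕ} (α : ℝ) (n : ℕ) (f : Pt d → ℝ) : ℝ :=
  sSup {ε : ℝ | 0 < ε ∧ (n : ℝ) ≤ ε ^ (-(2 + (d : ℝ) / α)) * levelVolume f ε}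

/-- An active optimization algorithm with `n` queries on the cube: query maps and a final
estimate, depending on the past queries and observations and on a random seed in `𝒰`. -/
structure ActiveAlgorithm (d n : ℕ) (𝒰 : Type*) [MeasurableSpace 𝒰] where
  query : (t : Fin n) → (Fin t → Pt d × ℝ) × 𝒰 → Pt d
  estimate : (Fin n → Pt d × ℝ) × 𝒰 → Pt d
  measurable_query : ∀ t, Measurable (query t)
  measurable_estimate : Measurable estimate
  query_mem : ∀ t p, query t p ∈ cube d
  estimate_mem : ∀ p, estimate p ∈ cube d

variable {d n : ℕ} {𝒰 : Type*} [MeasurableSpace 𝒰]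

/-- The first `t` pairs `(x_s, y_s)` produced on the function `f` with seed `u` and
noise `w`, where `y_s = f (x_s) + w_s`. -/
def ActiveAlgorithm.history (A : ActiveAlgorithm d n 𝒰) (f : Pt d → ℝ) (u : 𝒰)
    (w : Fin n → ℝ) : (t : ℕ) → t ≤ n → Fin t → Pt d × ℝ
  | 0, _ => Fin.elim0
  | t + 1, h =>
    let past := A.history f u w t (Nat.le_of_succ_le h)
    let x := A.query ⟨t, h⟩ (past, u)
    Fin.snoc (α := fun _ => Pt d × ℝ) past (x, f x + w ⟨t, h⟩)

/-- The final estimate `x̂_n`. -/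
def ActiveAlgorithm.output (A : ActiveAlgorithm d n 𝒰) (f : Pt d → ℝ)
    (p : 𝒰 × (Fin n → ℝ)) : Pt d :=
  A.estimate (A.history f p.1 p.2 n le_rfl, p.1)

/-- The joint law of the seed, with law `ν`, and of `n` i.i.d. standard Gaussian noise
variables independent of it. -/
def seedNoiseLaw (n : ℕ) {𝒰 : Type*} [MeasurableSpace 𝒰] (ν : Measure 𝒰) :
    Measure (𝒰 × (Fin n → ℝ)) :=
  ν.prod (Measure.pi fun _ => gaussianReal 0 1)

end

end ZerothOrder

/-!
A bump of height `2 ε` and radius `δ = r ε ^ (1 / α)` has Hölder norm of order `r ^ (-α)`, whatever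
`ε ≤ 1` is (`exists_scaledBump_mem_holderClass`). Subtract from `f₀` such a bump around a point `c`
of the level set `L_{f₀}(ε)`, where `ε` is the local rate. The minimum drops by at least `ε`, so that
an estimate outside the ball `B(c, δ)` has error at least `ε` (`le_optError_of_notMem`): to optimize
the perturbed function one has to locate the bump.

The packing property provides `m` disjoint balls `B(c, δ)` in `L_{f₀}(ε)`. Since every level set
contains a ball of radius `c₀'` (`volume_closedBall_le_levelVolume`), `m` is at least a constant
times `δ ^ (-d)`, hence at least a multiple of `ε ^ (-d / α)` that is large when `r` is small. The
definition of the rate, with the volume of the level set at most one, gives `n ε ^ 2 ≤ ε ^ (-d / α)`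
(`lowerRate_rpow_le`). So `m` exceeds a large multiple of `max 1 (n ε ^ 2)`, and the constant `M` is
determined by `r`.

It remains to see that `n` noisy queries cannot locate one bump among `m`
(`ActiveAlgorithm.exists_one_third_le_seedNoiseLaw`). For a fixed seed, the law of the history under
`f + g` has the density `L = exp (Z - Q / 2)` with respect to its law under `f`, where
`Z = ∑ g(x_t) w_t` is a martingale and `Q = ∑ g(x_t) ^ 2` its quadratic variation
(`ActiveAlgorithm.lintegral_history_add`). From `L ≥ 1 + Z - Q / 2`, `|Z| ≤ 1 / 4 + Z ^ 2` and
`E Z ^ 2 = E Q` (`ActiveAlgorithm.lintegral_score_sq`), an event loses at most `1 / 4 + 3 / 2 * E Q`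
of its probability on passing from `f` to `f + g`. This bound is linear in `Q`, and the energies of
bumps with disjoint supports sum to at most `4 ε ^ 2 n` because each query sees at most one of them
(`ActiveAlgorithm.sum_energy_le`). Averaging over the `m` bumps, of which the estimate under `f₀`
hits at most one, concludes.
-/

open scoped ContDiff

namespace ZerothOrder

/-! ### The cube -/

lemma isClosed_cube (d : ℕ) : IsClosed (cube d) := by
  have : cube d = ⋂ i, (fun x : Pt d => x i) ⁻¹' Set.Icc (0 : ℝ) 1 := by
    ext x; simp [cube]
  rw [this]
  exact isClosed_iInter fun i => isClosed_Icc.preimage (by fun_prop)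

lemma convex_cube (d : ℕ) : Convex ℝ (cube d) := by
  intro x hx y hy a b ha hb hab i
  have := (convex_Icc (0 : ℝ) 1) (hx i) (hy i) ha hb hab
  simpa using this

lemma nonempty_interior_cube (d : ℕ) : (interior (cube d)).Nonempty := by
  refine ⟨WithLp.toLp 2 fun _ => 1 / 2, mem_interior.2 ⟨Metric.ball _ (1 / 2), ?_,
    Metric.isOpen_ball, Metric.mem_ball_self (by norm_num)⟩⟩
  intro x hx i
  have h1 := PiLp.norm_apply_le (x - WithLp.toLp 2 fun _ : Fin d => (1 / 2 : ℝ)) i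
  rw [mem_ball_iff_norm] at hx
  have h2 := h1.trans hx.le
  simp only [PiLp.sub_apply, Real.norm_eq_abs] at h2
  rw [abs_le] at h2
  constructor <;> linarith [h2.1, h2.2]

lemma uniqueDiffOn_cube (d : ℕ) : UniqueDiffOn ℝ (cube d) :=
  uniqueDiffOn_convex (convex_cube d) (nonempty_interior_cube d)

lemma volume_cube (d : ℕ) : volume (cube d) = 1 := by
  have h : cube d = (WithLp.ofLp : Pt d → Fin d → ℝ) ⁻¹' Set.Icc 0 1 := by
    ext x
    simp [cube, Pi.le_def, forall_and]
  rw [h, (PiLp.volume_preserving_ofLp (Fin d)).measure_preimage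
    measurableSet_Icc.nullMeasurableSet, Real.volume_Icc_pi]
  simp

/-- A relatively open nonempty part of the cube has positive volume. -/
lemma volume_pos_of_continuousOn {d : ℕ} {f : Pt d → ℝ} (hf : ContinuousOn f (cube d)) {c : ℝ}
    {x : Pt d} (hx : x ∈ cube d) (hfx : f x < c) : 0 < volume {y | y ∈ cube d ∧ f y ≤ c} := by
  obtain ⟨U, hU, hUc⟩ := (continuousOn_iff'.1 hf) (Set.Iio c) isOpen_Iio
  have hxU : x ∈ U := (hUc.subset ⟨hfx, hx⟩).1
  have hcl : x ∈ closure (interior (cube d)) := by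
    rw [(convex_cube d).closure_interior_eq_closure_of_nonempty_interior
      (nonempty_interior_cube d)]
    exact subset_closure hx
  have hne : (U ∩ interior (cube d)).Nonempty := mem_closure_iff.1 hcl U hU hxU
  refine lt_of_lt_of_le ((hU.inter isOpen_interior).measure_pos volume hne) (measure_mono ?_)
  rintro y ⟨hyU, hy⟩
  have hy' := interior_subset hy
  exact ⟨hy', le_of_lt (hUc.superset ⟨hyU, hy'⟩).1⟩

/-! ### Hölder classes -/

lemma supNorm_nonneg {d : ℕ} (x : Pt d) : 0 ≤ supNorm x := norm_nonneg _

lemma supNorm_le_norm {d : ℕ} (x : Pt d) : supNorm x ≤ ‖x‖ :=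
  (pi_norm_le_iff_of_nonneg (norm_nonneg _)).2 fun i => PiLp.norm_apply_le x i

lemma norm_le_sqrt_mul_supNorm {d : ℕ} (x : Pt d) : ‖x‖ ≤ √d * supNorm x := by
  rw [EuclideanSpace.norm_eq]
  calc √(∑ i, ‖x i‖ ^ 2) ≤ √(∑ _i : Fin d, supNorm x ^ 2) := by
        gcongr with i
        exact norm_le_pi_norm (WithLp.ofLp x) i
    _ = √d * supNorm x := by
        simp [Real.sqrt_mul, Real.sqrt_sq (supNorm_nonneg x)]

lemma supNorm_smul {d : ℕ} (c : ℝ) (x : Pt d) : supNorm (c • x) = |c| * supNorm x := by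
  simp [supNorm, norm_smul]

lemma length_multiIndexWord {d : ℕ} (a : Fin d → ℕ) :
    (multiIndexWord a).length = ∑ i, a i := by
  simp [multiIndexWord, List.length_flatMap, Fin.sum_univ_def]

lemma length_of_mem_multiIndices {d j : ℕ} {a : Fin d → ℕ} (ha : a ∈ multiIndices d j) :
    (multiIndexWord a).length = j := by
  rw [length_multiIndexWord]
  exact (Finset.mem_piAntidiag.1 ha).1

lemma multiIndices_zero (d : ℕ) : multiIndices d 0 = {0} := by
  simp [multiIndices]

lemma partialDeriv_zero {d : ℕ} (f : Pt d → ℝ) (x : Pt d) : partialDeriv f 0 x = f x := by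
  have h : (multiIndexWord (0 : Fin d → ℕ)).length = 0 := by simp [length_multiIndexWord]
  unfold partialDeriv
  generalize (fun m => EuclideanSpace.single ((multiIndexWord (0 : Fin d → ℕ)).get m) (1 : ℝ)) = v
  revert v
  rw [h]
  intro v
  simp

/-- Iterated derivatives are additive for functions that are only `k` times differentiable,
without continuity of the last derivative. -/
lemma iteratedFDerivWithin_add_of_differentiableTimesOnCube {d k : ℕ} {f g : Pt d → ℝ}
    (hf : DifferentiableTimesOnCube k f) (hg : DifferentiableTimesOnCube k g) {j : ℕ} (hj : j ≤ k)
    {x : Pt d} (hx : x ∈ cube d) :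
    iteratedFDerivWithin ℝ j (f + g) (cube d) x =
      iteratedFDerivWithin ℝ j f (cube d) x + iteratedFDerivWithin ℝ j g (cube d) x := by
  induction j generalizing x with
  | zero => ext; simp
  | succ j ih =>
    have h := fderivWithin_congr (𝕜 := ℝ) (x := x)
      (f₁ := iteratedFDerivWithin ℝ j (f + g) (cube d))
      (f := iteratedFDerivWithin ℝ j f (cube d) + iteratedFDerivWithin ℝ j g (cube d))
      (fun y hy => ih (by omega) hy) (ih (by omega) hx)
    rw [fderivWithin_add (uniqueDiffOn_cube d x hx) (hf j (by omega) x hx)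
      (hg j (by omega) x hx)] at h
    simp only [iteratedFDerivWithin_succ_eq_comp_left, Function.comp_apply, h, map_add]

lemma DifferentiableTimesOnCube.add {d k : ℕ} {f g : Pt d → ℝ}
    (hf : DifferentiableTimesOnCube k f) (hg : DifferentiableTimesOnCube k g) :
    DifferentiableTimesOnCube k (f + g) := fun j hj =>
  ((hf j hj).add (hg j hj)).congr fun _ hx =>
    iteratedFDerivWithin_add_of_differentiableTimesOnCube hf hg hj.le hx

lemma add_mem_holderClass {d : ℕ} {α M₁ M₂ : ℝ} {f g : Pt d → ℝ} (hf : f ∈ HolderClass d α M₁)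
    (hg : g ∈ HolderClass d α M₂) : f + g ∈ HolderClass d α (M₁ + M₂) := by
  refine ⟨hf.1.add hg.1, fun x hx x' hx' => ?_⟩
  have hadd : ∀ j ≤ ⌊α⌋₊, ∀ a ∈ multiIndices d j, ∀ y ∈ cube d,
      partialDeriv (f + g) a y = partialDeriv f a y + partialDeriv g a y := by
    intro j hj a ha y hy
    unfold partialDeriv
    rw [iteratedFDerivWithin_add_of_differentiableTimesOnCube hf.1 hg.1
      ((length_of_mem_multiIndices ha).trans_le hj) hy]
    rfl
  refine le_trans ?_ (add_le_add (hf.2 x hx x' hx') (hg.2 x hx x' hx'))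
  rw [add_add_add_comm]
  refine add_le_add ?_ ?_
  · simp only [← Finset.sum_add_distrib]
    refine Finset.sum_le_sum fun j hj => Finset.sum_le_sum fun a ha => ?_
    rw [hadd j (Nat.lt_succ_iff.1 (Finset.mem_range.1 hj)) a ha x hx]
    exact abs_add_le _ _
  · rw [← Finset.sum_add_distrib]
    refine Finset.sum_le_sum fun a ha => ?_
    rw [hadd _ le_rfl a ha x hx, hadd _ le_rfl a ha x' hx', ← add_div, add_sub_add_comm]
    exact div_le_div_of_nonneg_right (abs_add_le _ _) (Real.rpow_nonneg (supNorm_nonneg _) _)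

lemma abs_le_of_mem_holderClass {d : ℕ} {α M : ℝ} {f : Pt d → ℝ} (hf : f ∈ HolderClass d α M)
    {x : Pt d} (hx : x ∈ cube d) : |f x| ≤ M := by
  have h := hf.2 x hx x hx
  have h0 : |f x| ≤ ∑ j ∈ Finset.range (⌊α⌋₊ + 1), ∑ a ∈ multiIndices d j, |partialDeriv f a x| := by
    rw [Finset.sum_range_succ', multiIndices_zero, Finset.sum_singleton, partialDeriv_zero]
    exact le_add_of_nonneg_left
      (Finset.sum_nonneg fun _ _ => Finset.sum_nonneg fun _ _ => abs_nonneg _)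
  simp only [sub_self, abs_zero, zero_div, Finset.sum_const_zero, add_zero] at h
  exact h0.trans h

lemma bddBelow_of_mem_holderClass {d : ℕ} {α M : ℝ} {f : Pt d → ℝ} (hf : f ∈ HolderClass d α M) :
    BddBelow (f '' cube d) := by
  refine ⟨-M, ?_⟩
  rintro _ ⟨x, hx, rfl⟩
  exact (abs_le.1 (abs_le_of_mem_holderClass hf hx)).1

lemma continuousOn_of_mem_holderClass {d : ℕ} {α M : ℝ} (hα : 0 < α) {f : Pt d → ℝ}
    (hf : f ∈ HolderClass d α M) : ContinuousOn f (cube d) := by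
  rcases Nat.eq_zero_or_pos ⌊α⌋₊ with h0 | hpos
  · have key : ∀ x ∈ cube d, ∀ x' ∈ cube d, |f x - f x'| ≤ M * ‖x - x'‖ ^ α := by
      intro x hx x' hx'
      have hM : 0 ≤ M := (abs_nonneg _).trans (abs_le_of_mem_holderClass hf hx)
      rcases eq_or_ne x x' with rfl | hne
      · simp [Real.zero_rpow hα.ne']
      have h := hf.2 x hx x' hx'
      rw [h0] at h
      simp only [multiIndices_zero, Finset.sum_singleton, partialDeriv_zero, Nat.cast_zero,
        sub_zero] at h
      have h2 : |f x - f x'| / supNorm (x - x') ^ α ≤ M :=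
        (le_add_of_nonneg_left
          (Finset.sum_nonneg fun _ _ => Finset.sum_nonneg fun _ _ => abs_nonneg _)).trans h
      have hs : 0 < supNorm (x - x') := by
        refine norm_pos_iff.2 fun h => hne ?_
        rw [← sub_eq_zero]
        exact (WithLp.ofLp_eq_zero 2).1 h
      rw [div_le_iff₀ (Real.rpow_pos_of_pos hs α)] at h2
      refine h2.trans ?_
      gcongr
      exact supNorm_le_norm _
    intro x hx
    rw [ContinuousWithinAt, tendsto_iff_dist_tendsto_zero]
    have hlim : Filter.Tendsto (fun y => M * ‖y - x‖ ^ α) (nhdsWithin x (cube d)) (nhds 0) := by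
      have : Continuous fun y : Pt d => M * ‖y - x‖ ^ α :=
        continuous_const.mul ((continuous_id.sub continuous_const).norm.rpow_const
          fun _ => Or.inr hα.le)
      have h := (this.tendsto x).mono_left (nhdsWithin_le_nhds (s := cube d))
      simpa [Real.zero_rpow hα.ne'] using h
    refine squeeze_zero' (Filter.Eventually.of_forall fun _ => dist_nonneg) ?_ hlim
    filter_upwards [self_mem_nhdsWithin] with y hy
    rw [Real.dist_eq]
    exact key y hy x hx
  · have h := (hf.1 0 hpos).continuousOn
    have h2 : f = fun x => iteratedFDerivWithin ℝ 0 f (cube d) x ![] := by ext; simp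
    rw [h2]
    exact h.eval_const _

/-! ### Localized perturbations -/

/-- The bump `φ((x - c) / δ)`, where `φ` is a fixed smooth function with values in `[0, 1]`, with
`φ(0) = 1` and supported in the unit ball. -/
noncomputable def scaledBump {d : ℕ} (c : Pt d) (δ : ℝ) (x : Pt d) : ℝ :=
  (⟨1 / 2, 1, by norm_num, by norm_num⟩ : ContDiffBump (0 : Pt d)) (δ⁻¹ • (x - c))

lemma scaledBump_nonneg {d : ℕ} (c : Pt d) (δ : ℝ) (x : Pt d) : 0 ≤ scaledBump c δ x :=
  ContDiffBump.nonneg _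

lemma scaledBump_le_one {d : ℕ} (c : Pt d) (δ : ℝ) (x : Pt d) : scaledBump c δ x ≤ 1 :=
  ContDiffBump.le_one _

lemma scaledBump_self {d : ℕ} (c : Pt d) (δ : ℝ) : scaledBump c δ c = 1 := by
  refine ContDiffBump.one_of_mem_closedBall _ ?_
  simp

lemma scaledBump_eq_zero {d : ℕ} {c x : Pt d} {δ : ℝ} (hδ : 0 < δ)
    (hx : x ∉ Metric.closedBall c δ) : scaledBump c δ x = 0 := by
  refine ContDiffBump.zero_of_le_dist _ ?_
  rw [Metric.mem_closedBall, not_le, dist_eq_norm] at hx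
  rw [dist_zero_right, norm_smul, norm_inv, Real.norm_eq_abs, abs_of_pos hδ, ← div_eq_inv_mul,
    one_le_div hδ]
  exact hx.le

lemma continuous_scaledBump {d : ℕ} (c : Pt d) (δ : ℝ) : Continuous (scaledBump c δ) :=
  (ContDiffBump.continuous _).comp (by fun_prop)

/-- Rescaling to radius `δ` multiplies the derivatives of order `ℓ` by `δ^{-ℓ}`. -/
lemma partialDeriv_rescale {d : ℕ} {φ : Pt d → ℝ} (hφ : ContDiff ℝ ∞ φ) (A δ : ℝ) (c : Pt d)
    (a : Fin d → ℕ) {x : Pt d} (hx : x ∈ cube d) :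
    partialDeriv (fun y => A * φ (δ⁻¹ • (y - c))) a x =
      A * δ⁻¹ ^ (multiIndexWord a).length *
        iteratedFDeriv ℝ (multiIndexWord a).length φ (δ⁻¹ • (x - c))
          fun m => EuclideanSpace.single ((multiIndexWord a).get m) (1 : ℝ) := by
  unfold partialDeriv
  have h2 : ContDiff ℝ ∞ fun y : Pt d => φ (δ⁻¹ • (y - c)) := hφ.comp (by fun_prop)
  have h3 : ContDiff ℝ ∞ fun y : Pt d => A • φ (δ⁻¹ • (y - c)) := h2.const_smul A
  have hℓ : ((multiIndexWord a).length : WithTop ℕ∞) ≤ (∞ : WithTop ℕ∞) := by exact_mod_cast le_top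
  simp only [← smul_eq_mul (a := A)]
  rw [iteratedFDerivWithin_eq_iteratedFDeriv (uniqueDiffOn_cube d)
    (h3.contDiffAt.of_le hℓ) hx,
    iteratedFDeriv_const_smul_apply' (h2.contDiffAt.of_le hℓ),
    iteratedFDeriv_comp_sub (f := fun y : Pt d => φ (δ⁻¹ • y)),
    iteratedFDeriv_comp_const_smul _ (hφ.of_le hℓ)]
  simp only [smul_apply, smul_eq_mul, mul_assoc]

lemma differentiableTimesOnCube_of_contDiff {d : ℕ} {f : Pt d → ℝ} (hf : ContDiff ℝ ∞ f) (k : ℕ) :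
    DifferentiableTimesOnCube k f := fun j _ =>
  hf.contDiffOn.differentiableOn_iteratedFDerivWithin (by exact_mod_cast ENat.natCast_lt_top j)
    (uniqueDiffOn_cube d)

lemma abs_multilinear_single_le {d ℓ : ℕ} (T : ContinuousMultilinearMap ℝ (fun _ : Fin ℓ => Pt d) ℝ)
    (v : Fin ℓ → Fin d) : |T fun m => EuclideanSpace.single (v m) (1 : ℝ)| ≤ ‖T‖ := by
  have h := T.le_opNorm fun m => EuclideanSpace.single (v m) (1 : ℝ)
  simpa using h

/-- Interpolation between a sup bound and a Lipschitz bound gives a Hölder bound of any exponent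
`β ∈ [0, 1]`. -/
lemma holder_bound_of_bound_of_lipschitz {D B K s β : ℝ} (hβ : 0 ≤ β) (hβ1 : β ≤ 1) (hs : 0 ≤ s)
    (hK : 0 ≤ K) (hD0 : 0 ≤ D) (hB : D ≤ B) (hL : D ≤ K * s) : D ≤ (B + K) * s ^ β := by
  have hB0 : 0 ≤ B := hD0.trans hB
  rcases le_total s 1 with h | h
  · rcases hs.eq_or_lt with rfl | hpos
    · have : D ≤ 0 := by simpa using hL
      exact this.trans (mul_nonneg (by positivity) (Real.rpow_nonneg le_rfl _))
    have h1 : s ≤ s ^ β := by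
      simpa using Real.rpow_le_rpow_of_exponent_ge hpos h hβ1
    calc D ≤ K * s := hL
      _ ≤ K * s ^ β := by gcongr
      _ ≤ (B + K) * s ^ β := by gcongr; linarith
  · have h1 : 1 ≤ s ^ β := Real.one_le_rpow h hβ
    calc D ≤ B := hB
      _ ≤ (B + K) * 1 := by linarith
      _ ≤ (B + K) * s ^ β := by gcongr

/-- A bump of height `A` and radius `δ ≤ 1` has Hölder norm of order `|A| δ^{-α}`. -/
lemma exists_scaledBump_mem_holderClass (d : ℕ) {α : ℝ} (hα : 0 < α) :
    ∃ C : ℝ, 0 < C ∧ ∀ (A : ℝ) (c : Pt d) (δ : ℝ), 0 < δ → δ ≤ 1 →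
      (fun x => A * scaledBump c δ x) ∈ HolderClass d α (C * (|A| * δ ^ (-α))) := by
  set k := ⌊α⌋₊
  let φ : Pt d → ℝ := (⟨1 / 2, 1, by norm_num, by norm_num⟩ : ContDiffBump (0 : Pt d))
  have hφ : ContDiff ℝ ∞ φ := ContDiffBump.contDiff _
  have hφc : HasCompactSupport φ := ContDiffBump.hasCompactSupport _
  have hB : ∀ j : ℕ, ∃ B : ℝ, ∀ u, ‖iteratedFDeriv ℝ j φ u‖ ≤ B := fun j =>
    (hφc.iteratedFDeriv j).exists_bound_of_continuous
      (hφ.continuous_iteratedFDeriv (by exact_mod_cast le_top))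
  choose B hB using hB
  have hB0 : ∀ j, 0 ≤ B j := fun j => (norm_nonneg _).trans (hB j 0)
  obtain ⟨K, hK⟩ : ∃ K, LipschitzWith K (iteratedFDeriv ℝ k φ) :=
    ContDiff.lipschitzWith_of_hasCompactSupport (hφc.iteratedFDeriv k)
      (hφ.iteratedFDeriv_right (m := 1) (by exact_mod_cast le_top)) one_ne_zero
  set H : ℝ := 2 * B k + K * √d
  have hβ : 0 ≤ α - k := sub_nonneg.2 (Nat.floor_le hα.le)
  have hβ1 : α - k ≤ 1 := by linarith [Nat.lt_floor_add_one α]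
  have hH0 : 0 ≤ H := by have := hB0 k; positivity
  set S : ℝ := ∑ j ∈ Finset.range (k + 1), ∑ _a ∈ multiIndices d j, B j
  have hS0 : 0 ≤ S := Finset.sum_nonneg fun j _ => Finset.sum_nonneg fun _ _ => hB0 j
  refine ⟨S + ∑ _a ∈ multiIndices d k, H + 1, by positivity, fun A c δ hδ hδ1 => ⟨?_, ?_⟩⟩
  · have h2 : ContDiff ℝ ∞ fun y : Pt d => A * φ (δ⁻¹ • (y - c)) :=
      contDiff_const.mul (hφ.comp (by fun_prop))
    exact differentiableTimesOnCube_of_contDiff h2 k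
  intro x hx x' hx'
  have hP : 0 ≤ |A| * δ ^ (-α) := by positivity
  have hpow : ∀ j ≤ k, δ⁻¹ ^ j ≤ δ ^ (-α) := by
    intro j hj
    rw [Real.rpow_neg hδ.le, ← Real.inv_rpow hδ.le, ← Real.rpow_natCast]
    refine Real.rpow_le_rpow_of_exponent_le ((one_le_inv₀ hδ).2 hδ1) ?_
    have : (j : ℝ) ≤ k := by exact_mod_cast hj
    linarith
  have hpd : ∀ a : Fin d → ℕ, ∀ y ∈ cube d, partialDeriv (fun x => A * scaledBump c δ x) a y = _ :=
    fun a y hy => partialDeriv_rescale hφ A δ c a hy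
  rw [add_mul, add_mul, one_mul, Finset.sum_mul, Finset.sum_mul]
  refine le_add_of_le_of_nonneg (add_le_add (Finset.sum_le_sum fun j hj => ?_)
    (Finset.sum_le_sum fun a ha => ?_)) hP
  · rw [Finset.sum_mul]
    refine Finset.sum_le_sum fun a ha => ?_
    have hjk : j ≤ k := Nat.lt_succ_iff.1 (Finset.mem_range.1 hj)
    have hb := (abs_multilinear_single_le _ (multiIndexWord a).get).trans
      (hB (multiIndexWord a).length (δ⁻¹ • (x - c)))
    have hlen := length_of_mem_multiIndices ha
    rw [hpd a x hx, abs_mul, abs_mul, abs_of_nonneg (by positivity : 0 ≤ δ⁻¹ ^ _), mul_comm (B j)]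
    refine mul_le_mul ?_ (hb.trans_eq (by rw [hlen])) (abs_nonneg _) hP
    gcongr
    exact hpow _ (hlen.trans_le hjk)
  · refine div_le_of_le_mul₀ (Real.rpow_nonneg (supNorm_nonneg _) _) (by positivity) ?_
    have hlen := length_of_mem_multiIndices ha
    rw [hpd a x hx, hpd a x' hx', ← mul_sub, abs_mul, abs_mul,
      abs_of_nonneg (by positivity : 0 ≤ δ⁻¹ ^ _)]
    have hΔ : ∀ v : Fin (multiIndexWord a).length → Fin d,
        |iteratedFDeriv ℝ (multiIndexWord a).length φ (δ⁻¹ • (x - c))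
            (fun m => EuclideanSpace.single (v m) (1 : ℝ)) -
          iteratedFDeriv ℝ (multiIndexWord a).length φ (δ⁻¹ • (x' - c))
            (fun m => EuclideanSpace.single (v m) (1 : ℝ))| ≤
          H * (δ⁻¹ * supNorm (x - x')) ^ (α - k) := by
      rw [hlen]
      intro v
      rw [← sub_apply]
      refine (abs_multilinear_single_le _ v).trans ?_
      refine holder_bound_of_bound_of_lipschitz hβ hβ1
        (mul_nonneg (by positivity) (supNorm_nonneg _)) (by positivity) (norm_nonneg _) ?_ ?_
      · refine (norm_sub_le _ _).trans ?_
        linarith [hB k (δ⁻¹ • (x - c)), hB k (δ⁻¹ • (x' - c))]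
      · have h := hK.dist_le_mul (δ⁻¹ • (x - c)) (δ⁻¹ • (x' - c))
        rw [dist_eq_norm, dist_eq_norm, ← smul_sub, sub_sub_sub_cancel_right] at h
        refine h.trans ?_
        rw [mul_assoc]
        refine mul_le_mul_of_nonneg_left ?_ K.2
        refine (norm_le_sqrt_mul_supNorm _).trans_eq ?_
        rw [supNorm_smul, abs_of_pos (inv_pos.2 hδ)]
    refine (mul_le_mul_of_nonneg_left (hΔ _) (by positivity)).trans_eq ?_
    have hδk : δ⁻¹ ^ k * δ⁻¹ ^ (α - k) = δ ^ (-α) := by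
      rw [Real.rpow_neg hδ.le, ← Real.inv_rpow hδ.le, ← Real.rpow_natCast,
        ← Real.rpow_add (by positivity)]
      congr 1; ring
    rw [hlen, Real.mul_rpow (by positivity) (supNorm_nonneg _), ← hδk]
    ring

variable {d n : ℕ} {𝒰 : Type*} [MeasurableSpace 𝒰]

/-! ### Gaussian noise -/

/-- The Cameron–Martin formula in dimension one. -/
lemma lintegral_add_gaussianReal {F : ℝ → ℝ≥0∞} (hF : Measurable F) (a : ℝ) :
    ∫⁻ z, F (a + z) ∂gaussianReal 0 1 =
      ∫⁻ z, ENNReal.ofReal (Real.exp (a * z - a ^ 2 / 2)) * F z ∂gaussianReal 0 1 := by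
  have h1 : ∫⁻ z, F (a + z) ∂gaussianReal 0 1 = ∫⁻ z, F z ∂gaussianReal a 1 := by
    have h := gaussianReal_map_const_add (μ := 0) (v := 1) a
    rw [zero_add] at h
    rw [← h, lintegral_map hF (by fun_prop)]
  rw [h1, gaussianReal_of_var_ne_zero _ one_ne_zero, gaussianReal_of_var_ne_zero _ one_ne_zero,
    lintegral_withDensity_eq_lintegral_mul _ (measurable_gaussianPDF _ _) hF,
    lintegral_withDensity_eq_lintegral_mul _ (measurable_gaussianPDF _ _) (by fun_prop)]
  refine lintegral_congr fun z => ?_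
  simp only [Pi.mul_apply, ← mul_assoc]
  congr 1
  rw [gaussianPDF, gaussianPDF, ← ENNReal.ofReal_mul (gaussianPDFReal_nonneg _ _ _)]
  congr 1
  simp only [gaussianPDFReal]
  rw [mul_assoc (_⁻¹), ← Real.exp_add]
  congr 2
  simp only [NNReal.coe_one]
  ring

lemma lintegral_sq_add_mul_gaussianReal (b a : ℝ) :
    ∫⁻ z, ENNReal.ofReal ((b + a * z) ^ 2) ∂gaussianReal 0 1 = ENNReal.ofReal (b ^ 2 + a ^ 2) := by
  have h1 : Integrable (fun z : ℝ => z) (gaussianReal 0 1) :=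
    (memLp_id_gaussianReal 1).integrable (by simp)
  have h2 : Integrable (fun z : ℝ => z ^ 2) (gaussianReal 0 1) :=
    (memLp_id_gaussianReal 2).integrable_sq
  have hz : ∫ z, z ∂gaussianReal 0 1 = 0 := by simp
  have hz2 : ∫ z, z ^ 2 ∂gaussianReal 0 1 = 1 := by
    have h := variance_of_integral_eq_zero (X := id) (μ := gaussianReal 0 1) aemeasurable_id
      (by simp)
    rw [variance_id_gaussianReal] at h
    simpa using h.symm
  have he : (fun z : ℝ => (b + a * z) ^ 2) = fun z => b ^ 2 + (2 * b * a * z + a ^ 2 * z ^ 2) := by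
    ext z; ring
  have h3 := h1.const_mul (2 * b * a)
  have h4 := h2.const_mul (a ^ 2)
  rw [← ofReal_integral_eq_lintegral_ofReal]
  · have e1 := integral_add (μ := gaussianReal 0 1) (integrable_const (b ^ 2)) (h3.add h4)
    have e2 := integral_add h3 h4
    simp only [Pi.add_apply] at e1
    rw [he, e1, e2, integral_const_mul, integral_const_mul, hz, hz2]
    simp
  · rw [he]
    exact (integrable_const _).add (h3.add h4)
  · exact Filter.Eventually.of_forall fun z => sq_nonneg _

/-- The law of the noise vector. -/
noncomputable abbrev noiseLaw (n : ℕ) : Measure (Fin n → ℝ) := Measure.pi fun _ => gaussianReal 0 1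

/-- Integrating out one noise coordinate `i`, when the remaining dependence of the integrand on
the noise does not involve that coordinate. -/
lemma lintegral_noiseLaw_coord (i : Fin n) {F : (Fin n → ℝ) → ℝ → ℝ≥0∞}
    (hF : Measurable (Function.uncurry F)) (hi : ∀ w z, F (Function.update w i z) = F w) :
    ∫⁻ w, F w (w i) ∂noiseLaw n = ∫⁻ w, ∫⁻ z, F w z ∂gaussianReal 0 1 ∂noiseLaw n := by
  refine lintegral_eq_of_lmarginal_eq {i} (hF.comp (measurable_id.prodMk (measurable_pi_apply i)))
    hF.lintegral_prod_right' ?_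
  rw [lmarginal_singleton, lmarginal_singleton]
  ext w
  simp [hi]

/-! ### Histories -/

lemma measurable_snoc {X : Type*} [MeasurableSpace X] (t : ℕ) :
    Measurable fun p : (Fin t → X) × X => (Fin.snoc (α := fun _ => X) p.1 p.2 : Fin (t + 1) → X) := by
  refine measurable_pi_iff.2 fun i => ?_
  refine Fin.lastCases ?_ (fun j => ?_) i
  · simpa using measurable_snd
  · simpa using! (measurable_pi_apply j).comp measurable_fst

namespace ActiveAlgorithm

variable (A : ActiveAlgorithm d n 𝒰)

/-- The query made at time `t` on the function `f`. -/
noncomputable def queryAt (f : Pt d → ℝ) (u : 𝒰) (t : ℕ) (h : t < n) (w : Fin n → ℝ) : Pt d :=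
  A.query ⟨t, h⟩ (A.history f u w t h.le, u)

lemma queryAt_mem (f : Pt d → ℝ) (u : 𝒰) (t : ℕ) (h : t < n) (w : Fin n → ℝ) :
    A.queryAt f u t h w ∈ cube d := A.query_mem _ _

lemma history_succ (f : Pt d → ℝ) (u : 𝒰) (w : Fin n → ℝ) (t : ℕ) (h : t + 1 ≤ n) :
    A.history f u w (t + 1) h =
      Fin.snoc (α := fun _ => Pt d × ℝ) (A.history f u w t (Nat.le_of_succ_le h))
        (A.queryAt f u t h w, f (A.queryAt f u t h w) + w ⟨t, h⟩) := rfl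

lemma history_congr {f g : Pt d → ℝ} (hfg : Set.EqOn f g (cube d)) (u : 𝒰) (w : Fin n → ℝ) (t : ℕ)
    (h : t ≤ n) : A.history f u w t h = A.history g u w t h := by
  induction t with
  | zero => rfl
  | succ t ih =>
    have hq : A.queryAt f u t h w = A.queryAt g u t h w := by
      unfold queryAt; rw [ih]
    rw [history_succ, history_succ, ih, hq, hfg (A.queryAt_mem g u t h w)]

lemma output_congr {f g : Pt d → ℝ} (hfg : Set.EqOn f g (cube d)) (p : 𝒰 × (Fin n → ℝ)) :
    A.output f p = A.output g p := by
  unfold output; rw [A.history_congr hfg]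

/-- The history up to time `t` does not involve the noise from time `t` on. -/
lemma history_update (f : Pt d → ℝ) (u : 𝒰) (w : Fin n → ℝ) (i : Fin n) (z : ℝ) (t : ℕ)
    (h : t ≤ n) (hti : t ≤ i) :
    A.history f u (Function.update w i z) t h = A.history f u w t h := by
  induction t with
  | zero => rfl
  | succ t ih =>
    have hq : A.queryAt f u t h (Function.update w i z) = A.queryAt f u t h w := by
      unfold queryAt; rw [ih _ (by omega)]
    have hne : (⟨t, h⟩ : Fin n) ≠ i := fun he => by
      have := congrArg Fin.val he
      simp at this; omega
    rw [history_succ, history_succ, ih _ (by omega), hq, Function.update_of_ne hne]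

lemma queryAt_update (f : Pt d → ℝ) (u : 𝒰) (w : Fin n → ℝ) (i : Fin n) (z : ℝ) (t : ℕ)
    (h : t < n) (hti : t ≤ i) :
    A.queryAt f u t h (Function.update w i z) = A.queryAt f u t h w := by
  unfold queryAt; rw [A.history_update f u w i z t h.le hti]

lemma measurable_history {f : Pt d → ℝ} (hf : Measurable f) (t : ℕ) (h : t ≤ n) :
    Measurable fun p : 𝒰 × (Fin n → ℝ) => A.history f p.1 p.2 t h := by
  induction t with
  | zero => exact measurable_const
  | succ t ih =>
    have ih' := ih (Nat.le_of_succ_le h)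
    have hq : Measurable fun p : 𝒰 × (Fin n → ℝ) => A.queryAt f p.1 t h p.2 :=
      (A.measurable_query ⟨t, h⟩).comp (ih'.prodMk measurable_fst)
    exact (measurable_snoc t).comp (ih'.prodMk (hq.prodMk ((hf.comp hq).add
      ((measurable_pi_apply _).comp measurable_snd))))

lemma measurable_output {f : Pt d → ℝ} (hf : Measurable f) : Measurable (A.output f) :=
  A.measurable_estimate.comp ((A.measurable_history hf n le_rfl).prodMk measurable_fst)

lemma measurable_history_right {f : Pt d → ℝ} (hf : Measurable f) (u : 𝒰) (t : ℕ) (h : t ≤ n) :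
    Measurable fun w => A.history f u w t h :=
  (A.measurable_history hf t h).comp measurable_prodMk_left

lemma measurable_queryAt {f : Pt d → ℝ} (hf : Measurable f) (u : 𝒰) (t : ℕ) (h : t < n) :
    Measurable (A.queryAt f u t h) :=
  (A.measurable_query ⟨t, h⟩).comp
    ((A.measurable_history_right hf u t h.le).prodMk measurable_const)

/-! ### Change of measure -/

variable (f g : Pt d → ℝ) (u : 𝒰)

/-- The log-likelihood ratio, after `t` queries made on `f`, of `f + g` against `f`, without its
quadratic compensator. It is a martingale. -/
noncomputable def score (t : ℕ) (h : t ≤ n) (w : Fin n → ℝ) : ℝ :=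
  ∑ i : Fin t, g (A.queryAt f u i (i.2.trans_le h) w) * w (Fin.castLE h i)

/-- The energy of the perturbation `g` along the first `t` queries made on `f`, which is the
quadratic variation of `score`. -/
noncomputable def energy (t : ℕ) (h : t ≤ n) (w : Fin n → ℝ) : ℝ :=
  ∑ i : Fin t, g (A.queryAt f u i (i.2.trans_le h) w) ^ 2

/-- The likelihood ratio of `f + g` against `f` after `t` queries, in terms of the noise under
`f`. -/
noncomputable def likelihoodRatio (t : ℕ) (h : t ≤ n) (w : Fin n → ℝ) : ℝ :=
  Real.exp (A.score f g u t h w - A.energy f g u t h w / 2)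

lemma score_succ (t : ℕ) (h : t + 1 ≤ n) (w : Fin n → ℝ) :
    A.score f g u (t + 1) h w = A.score f g u t (Nat.le_of_succ_le h) w +
      g (A.queryAt f u t h w) * w ⟨t, h⟩ := by
  unfold score; rw [Fin.sum_univ_castSucc]; rfl

lemma energy_succ (t : ℕ) (h : t + 1 ≤ n) (w : Fin n → ℝ) :
    A.energy f g u (t + 1) h w = A.energy f g u t (Nat.le_of_succ_le h) w +
      g (A.queryAt f u t h w) ^ 2 := by
  unfold energy; rw [Fin.sum_univ_castSucc]; rfl

lemma likelihoodRatio_succ (t : ℕ) (h : t + 1 ≤ n) (w : Fin n → ℝ) :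
    A.likelihoodRatio f g u (t + 1) h w = A.likelihoodRatio f g u t (Nat.le_of_succ_le h) w *
      Real.exp (g (A.queryAt f u t h w) * w ⟨t, h⟩ - g (A.queryAt f u t h w) ^ 2 / 2) := by
  unfold likelihoodRatio
  rw [score_succ, energy_succ, ← Real.exp_add]
  congr 1; ring

lemma energy_nonneg (t : ℕ) (h : t ≤ n) (w : Fin n → ℝ) : 0 ≤ A.energy f g u t h w :=
  Finset.sum_nonneg fun _ _ => sq_nonneg _

lemma score_update (t : ℕ) (h : t < n) (w : Fin n → ℝ) (z : ℝ) :
    A.score f g u t h.le (Function.update w ⟨t, h⟩ z) = A.score f g u t h.le w := by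
  refine Finset.sum_congr rfl fun i _ => ?_
  have hne : Fin.castLE h.le i ≠ ⟨t, h⟩ := fun he => by
    have := congrArg Fin.val he
    simp at this; omega
  rw [A.queryAt_update _ _ _ _ _ _ _ i.2.le, Function.update_of_ne hne]

lemma energy_update (t : ℕ) (h : t < n) (w : Fin n → ℝ) (z : ℝ) :
    A.energy f g u t h.le (Function.update w ⟨t, h⟩ z) = A.energy f g u t h.le w := by
  refine Finset.sum_congr rfl fun i _ => ?_
  rw [A.queryAt_update _ _ _ _ _ _ _ i.2.le]

lemma likelihoodRatio_update (t : ℕ) (h : t < n) (w : Fin n → ℝ) (z : ℝ) :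
    A.likelihoodRatio f g u t h.le (Function.update w ⟨t, h⟩ z) =
      A.likelihoodRatio f g u t h.le w := by
  unfold likelihoodRatio; rw [score_update, energy_update]

variable {f g}

lemma measurable_score (hf : Measurable f) (hg : Measurable g) (t : ℕ) (h : t ≤ n) :
    Measurable (A.score f g u t h) :=
  Finset.measurable_fun_sum _ fun _ _ =>
    (hg.comp (A.measurable_queryAt hf u _ _)).mul (measurable_pi_apply _)

lemma measurable_energy (hf : Measurable f) (hg : Measurable g) (t : ℕ) (h : t ≤ n) :
    Measurable (A.energy f g u t h) :=
  Finset.measurable_fun_sum _ fun _ _ => (hg.comp (A.measurable_queryAt hf u _ _)).pow_const 2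

lemma measurable_likelihoodRatio (hf : Measurable f) (hg : Measurable g) (t : ℕ) (h : t ≤ n) :
    Measurable (A.likelihoodRatio f g u t h) :=
  ((A.measurable_score u hf hg t h).sub ((A.measurable_energy u hf hg t h).div_const 2)).exp

/-- The law of the history under `f + g` has density `likelihoodRatio` with respect to its law
under `f`. -/
lemma lintegral_history_add (hf : Measurable f) (hg : Measurable g) (t : ℕ) (h : t ≤ n)
    {F : (Fin t → Pt d × ℝ) → ℝ≥0∞} (hF : Measurable F) :
    ∫⁻ w, F (A.history (f + g) u w t h) ∂noiseLaw n =
      ∫⁻ w, ENNReal.ofReal (A.likelihoodRatio f g u t h w) * F (A.history f u w t h)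
        ∂noiseLaw n := by
  induction t with
  | zero => simp [likelihoodRatio, score, energy, history]
  | succ t ih =>
    have h' : t ≤ n := Nat.le_of_succ_le h
    -- `G p z` is the integrand when `p` is followed by one more query `x`, with answer `f x + z`.
    let G : (Fin t → Pt d × ℝ) → ℝ → ℝ≥0∞ := fun p z =>
      F (Fin.snoc (α := fun _ => Pt d × ℝ) p
        (A.query ⟨t, h⟩ (p, u), f (A.query ⟨t, h⟩ (p, u)) + z))
    have hq : Measurable fun p : (Fin t → Pt d × ℝ) × ℝ => A.query ⟨t, h⟩ (p.1, u) :=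
      (A.measurable_query ⟨t, h⟩).comp (measurable_fst.prodMk measurable_const)
    have hG : Measurable (Function.uncurry G) :=
      hF.comp ((measurable_snoc t).comp (measurable_fst.prodMk (hq.prodMk
        ((hf.comp hq).add measurable_snd))))
    have hGs : Measurable fun p : (Fin t → Pt d × ℝ) × ℝ =>
        G p.1 (g (A.query ⟨t, h⟩ (p.1, u)) + p.2) :=
      hG.comp (measurable_fst.prodMk ((hg.comp hq).add measurable_snd))
    have hH := A.measurable_history_right (hf.add hg) u t h'
    have hH0 := A.measurable_history_right hf u t h'
    have hL := A.measurable_likelihoodRatio u hf hg t h'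
    have hQ := A.measurable_queryAt hf u t h
    calc ∫⁻ w, F (A.history (f + g) u w (t + 1) h) ∂noiseLaw n
        = ∫⁻ w, (fun w z => G (A.history (f + g) u w t h')
            (g (A.query ⟨t, h⟩ (A.history (f + g) u w t h', u)) + z)) w (w ⟨t, h⟩)
            ∂noiseLaw n := by
          refine lintegral_congr fun w => ?_
          rw [history_succ]
          simp only [G, queryAt, Pi.add_apply, add_assoc]
      _ = ∫⁻ w, ∫⁻ z, G (A.history (f + g) u w t h')
            (g (A.query ⟨t, h⟩ (A.history (f + g) u w t h', u)) + z) ∂gaussianReal 0 1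
            ∂noiseLaw n := by
          refine lintegral_noiseLaw_coord (F := fun w z => G (A.history (f + g) u w t h')
            (g (A.query ⟨t, h⟩ (A.history (f + g) u w t h', u)) + z)) ⟨t, h⟩ ?_ fun w z => ?_
          · exact hGs.comp ((hH.comp measurable_fst).prodMk measurable_snd)
          · rw [A.history_update (f + g) u w ⟨t, h⟩ z t h' le_rfl]
      _ = ∫⁻ w, ENNReal.ofReal (A.likelihoodRatio f g u t h' w) *
            ∫⁻ z, G (A.history f u w t h')
              (g (A.query ⟨t, h⟩ (A.history f u w t h', u)) + z) ∂gaussianReal 0 1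
            ∂noiseLaw n := ih h' hGs.lintegral_prod_right'
      _ = ∫⁻ w, ∫⁻ z, (fun w z => ENNReal.ofReal (A.likelihoodRatio f g u t h' w *
            Real.exp (g (A.queryAt f u t h w) * z - g (A.queryAt f u t h w) ^ 2 / 2)) *
              G (A.history f u w t h') z) w z ∂gaussianReal 0 1 ∂noiseLaw n := by
          refine lintegral_congr fun w => ?_
          have hGw : Measurable (G (A.history f u w t h')) := hG.comp measurable_prodMk_left
          rw [lintegral_add_gaussianReal hGw, ← lintegral_const_mul _ (by fun_prop)]
          refine lintegral_congr fun z => ?_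
          have hpos : 0 ≤ A.likelihoodRatio f g u t h' w := (Real.exp_pos _).le
          simp only [ENNReal.ofReal_mul hpos, mul_assoc]
          rfl
      _ = ∫⁻ w, ENNReal.ofReal (A.likelihoodRatio f g u (t + 1) h w) *
            F (A.history f u w (t + 1) h) ∂noiseLaw n := by
          rw [← lintegral_noiseLaw_coord ⟨t, h⟩]
          · refine lintegral_congr fun w => ?_
            rw [history_succ, likelihoodRatio_succ]
            rfl
          · refine Measurable.mul (ENNReal.measurable_ofReal.comp ?_)
              (hG.comp ((hH0.comp measurable_fst).prodMk measurable_snd))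
            exact (hL.comp measurable_fst).mul ((((hg.comp (hQ.comp measurable_fst)).mul
              measurable_snd).sub (((hg.comp (hQ.comp measurable_fst)).pow_const 2).div_const
                2)).exp)
          · intro w z
            ext z'
            rw [A.likelihoodRatio_update, A.history_update f u w ⟨t, h⟩ z t h' le_rfl,
              A.queryAt_update f u w ⟨t, h⟩ z t h le_rfl]

/-- The Itô isometry for the score. -/
lemma lintegral_score_sq (hf : Measurable f) (hg : Measurable g) (t : ℕ) (h : t ≤ n) :
    ∫⁻ w, ENNReal.ofReal (A.score f g u t h w ^ 2) ∂noiseLaw n =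
      ∫⁻ w, ENNReal.ofReal (A.energy f g u t h w) ∂noiseLaw n := by
  induction t with
  | zero => simp [score, energy]
  | succ t ih =>
    have h' : t ≤ n := Nat.le_of_succ_le h
    have hS := A.measurable_score u hf hg t h'
    have hE := A.measurable_energy u hf hg t h'
    have hQ := hg.comp (A.measurable_queryAt hf u t h)
    have h1 := lintegral_noiseLaw_coord (n := n) ⟨t, h⟩
      (F := fun w z => ENNReal.ofReal
        ((A.score f g u t h' w + g (A.queryAt f u t h w) * z) ^ 2))
      (ENNReal.measurable_ofReal.comp (((hS.comp measurable_fst).add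
        ((hQ.comp measurable_fst).mul measurable_snd)).pow_const 2)) fun w z => by
          ext z'
          rw [A.score_update, A.queryAt_update f u w ⟨t, h⟩ z t h le_rfl]
    simp only [score_succ, energy_succ]
    rw [h1]
    simp only [lintegral_sq_add_mul_gaussianReal]
    simp only [ENNReal.ofReal_add (sq_nonneg _) (sq_nonneg _),
      ENNReal.ofReal_add (A.energy_nonneg f g u t h' _) (sq_nonneg _)]
    rw [lintegral_add_left (hS.pow_const 2).ennreal_ofReal, lintegral_add_left hE.ennreal_ofReal,
      ih h']

/-- Passing from `f` to `f + g` cannot decrease the probability of an event by more than `1 / 4`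
plus a multiple of the mean energy of `g` along the queries made on `f`. -/
lemma noiseLaw_history_le (hf : Measurable f) (hg : Measurable g)
    {E : Set (Fin n → Pt d × ℝ)} (hE : MeasurableSet E) :
    noiseLaw n {w | A.history f u w n le_rfl ∈ E} ≤
      noiseLaw n {w | A.history (f + g) u w n le_rfl ∈ E} + (1 / 4 +
        ∫⁻ w, ENNReal.ofReal (3 / 2 * A.energy f g u n le_rfl w) ∂noiseLaw n) := by
  have hH := A.measurable_history_right hf u n le_rfl
  have hH' := A.measurable_history_right (hf.add hg) u n le_rfl
  have hL := A.measurable_likelihoodRatio u hf hg n le_rfl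
  have hS := A.measurable_score u hf hg n le_rfl
  have hQ := A.measurable_energy u hf hg n le_rfl
  have hI : ∀ {k : Pt d → ℝ}, Measurable (fun w => A.history k u w n le_rfl) →
      noiseLaw n {w | A.history k u w n le_rfl ∈ E} =
      ∫⁻ w, E.indicator 1 (A.history k u w n le_rfl) ∂noiseLaw n := fun hk => by
    exact (lintegral_indicator_one (hk hE)).symm
  have hm : Measurable (E.indicator (1 : (Fin n → Pt d × ℝ) → ℝ≥0∞)) := measurable_one.indicator hE
  rw [hI hH, hI hH', A.lintegral_history_add u hf hg n le_rfl hm]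
  have hsplit : ∫⁻ w, ENNReal.ofReal (3 / 2 * A.energy f g u n le_rfl w) ∂noiseLaw n =
      ∫⁻ w, ENNReal.ofReal (A.score f g u n le_rfl w ^ 2) ∂noiseLaw n +
        ∫⁻ w, ENNReal.ofReal (A.energy f g u n le_rfl w / 2) ∂noiseLaw n := by
    rw [A.lintegral_score_sq u hf hg, ← lintegral_add_left hQ.ennreal_ofReal]
    refine lintegral_congr fun w => ?_
    have := A.energy_nonneg f g u n le_rfl w
    rw [← ENNReal.ofReal_add this (by positivity)]
    congr 1; ring
  have hconst : (1 / 4 : ℝ≥0∞) = ∫⁻ _w, ENNReal.ofReal (1 / 4) ∂noiseLaw n := by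
    rw [lintegral_const, measure_univ, mul_one, ENNReal.ofReal_div_of_pos (by norm_num)]
    simp
  rw [hsplit, hconst, ← lintegral_add_left (hS.pow_const 2).ennreal_ofReal,
    ← lintegral_add_left measurable_const,
    ← lintegral_add_left (f := fun w => ENNReal.ofReal (A.likelihoodRatio f g u n le_rfl w) *
      E.indicator 1 (A.history f u w n le_rfl)) (hL.ennreal_ofReal.mul (hm.comp hH))]
  refine lintegral_mono fun w => ?_
  by_cases hw : A.history f u w n le_rfl ∈ E
  · have hQ0 := A.energy_nonneg f g u n le_rfl w
    have hL0 : 0 ≤ A.likelihoodRatio f g u n le_rfl w := (Real.exp_pos _).le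
    simp only [Set.indicator_of_mem hw, Pi.one_apply, mul_one]
    rw [← ENNReal.ofReal_add (sq_nonneg _) (by positivity),
      ← ENNReal.ofReal_add (by norm_num) (by positivity),
      ← ENNReal.ofReal_add hL0 (by positivity), ENNReal.one_le_ofReal]
    -- `exp x ≥ 1 + x` and `|z| ≤ 1 / 4 + z ^ 2`
    have hexp := Real.add_one_le_exp
      (A.score f g u n le_rfl w - A.energy f g u n le_rfl w / 2)
    have hsq := sq_nonneg (A.score f g u n le_rfl w + 1 / 2)
    unfold likelihoodRatio
    linarith
  · simp [Set.indicator_of_notMem hw]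

end ActiveAlgorithm

/-! ### Perturbations with disjoint supports -/

namespace ActiveAlgorithm

variable (A : ActiveAlgorithm d n 𝒰) {ι : Type*} {s : Finset ι} {B : ι → Set (Pt d)}
  {g : ι → Pt d → ℝ} {η : ℝ}

/-- Each query sees at most one of several perturbations with disjoint supports. -/
lemma sum_energy_le (hB : (s : Set ι).PairwiseDisjoint B) (hg0 : ∀ i ∈ s, ∀ x ∉ B i, g i x = 0)
    (hgη : ∀ i ∈ s, ∀ x, |g i x| ≤ η) (f : Pt d → ℝ) (u : 𝒰) (w : Fin n → ℝ) :
    ∑ i ∈ s, A.energy f (g i) u n le_rfl w ≤ η ^ 2 * n := by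
  have hpt : ∀ x, ∑ i ∈ s, g i x ^ 2 ≤ η ^ 2 := by
    intro x
    by_cases hx : ∃ i ∈ s, x ∈ B i
    · obtain ⟨i, hi, hxi⟩ := hx
      rw [Finset.sum_eq_single_of_mem i hi]
      · exact sq_le_sq' (abs_le.1 (hgη i hi x)).1 (abs_le.1 (hgη i hi x)).2
      · intro j hj hji
        rw [hg0 j hj x fun hxj => Set.disjoint_left.1 (hB hj hi hji) hxj hxi]
        simp
    · push Not at hx
      rw [Finset.sum_eq_zero fun i hi => by rw [hg0 i hi x (hx i hi)]; simp]
      positivity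
  unfold energy
  rw [Finset.sum_comm]
  refine (Finset.sum_le_sum fun t _ => hpt _).trans_eq ?_
  simp [mul_comm]

/-- For a fixed seed: an estimate lies in at most one of the disjoint sets `B i`, so that it
misses most of them under `f`, and still does so on average when `f` is replaced by `f + g i`. -/
lemma card_le_sum_noiseLaw (hB : (s : Set ι).PairwiseDisjoint B) (hBm : ∀ i, MeasurableSet (B i))
    (hg0 : ∀ i ∈ s, ∀ x ∉ B i, g i x = 0) (hgη : ∀ i ∈ s, ∀ x, |g i x| ≤ η) {f : Pt d → ℝ}
    (hf : Measurable f) (hg : ∀ i, Measurable (g i)) (u : 𝒰) :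
    (s.card : ℝ≥0∞) ≤ ∑ i ∈ s, noiseLaw n {w | A.output (f + g i) (u, w) ∉ B i} +
      (1 + s.card / 4 + ENNReal.ofReal (3 / 2 * (η ^ 2 * n))) := by
  have hE : ∀ i, MeasurableSet {h : Fin n → Pt d × ℝ | A.estimate (h, u) ∈ B i} := fun i =>
    (A.measurable_estimate.comp measurable_prodMk_right) (hBm i)
  have hin : ∀ i, MeasurableSet {w | A.output f (u, w) ∈ B i} := fun i =>
    ((A.measurable_output hf).comp measurable_prodMk_left) (hBm i)
  have h1 : ∑ i ∈ s, noiseLaw n {w | A.output f (u, w) ∈ B i} ≤ 1 := by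
    rw [← measure_biUnion_finset _ fun i _ => hin i]
    · exact prob_le_one
    · intro i hi j hj hij
      exact (hB hi hj hij).preimage fun w => A.output f (u, w)
  have h2 : ∀ i ∈ s, (1 : ℝ≥0∞) ≤ noiseLaw n {w | A.output f (u, w) ∈ B i} +
      (noiseLaw n {w | A.output (f + g i) (u, w) ∉ B i} + (1 / 4 +
        ∫⁻ w, ENNReal.ofReal (3 / 2 * A.energy f (g i) u n le_rfl w) ∂noiseLaw n)) := by
    intro i _
    refine (prob_add_prob_compl (μ := noiseLaw n) (hin i)).symm.trans_le ?_
    exact add_le_add le_rfl (A.noiseLaw_history_le u hf (hg i) (hE i).compl)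
  have h3 : ∑ i ∈ s, ∫⁻ w, ENNReal.ofReal (3 / 2 * A.energy f (g i) u n le_rfl w) ∂noiseLaw n ≤
      ENNReal.ofReal (3 / 2 * (η ^ 2 * n)) := by
    rw [← lintegral_finsetSum _ fun i _ =>
      ((A.measurable_energy u hf (hg i) n le_rfl).const_mul _).ennreal_ofReal]
    calc _ ≤ ∫⁻ _w, ENNReal.ofReal (3 / 2 * (η ^ 2 * n)) ∂noiseLaw n := by
          refine lintegral_mono fun w => ?_
          rw [← ENNReal.ofReal_sum_of_nonneg fun i _ =>
            mul_nonneg (by norm_num) (A.energy_nonneg _ _ _ _ _ _), ← Finset.mul_sum]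
          exact ENNReal.ofReal_le_ofReal
            (mul_le_mul_of_nonneg_left (A.sum_energy_le hB hg0 hgη f u w) (by norm_num))
      _ = _ := by simp
  calc (s.card : ℝ≥0∞) = ∑ i ∈ s, 1 := by simp
    _ ≤ _ := Finset.sum_le_sum h2
    _ = ∑ i ∈ s, noiseLaw n {w | A.output f (u, w) ∈ B i} +
        (∑ i ∈ s, noiseLaw n {w | A.output (f + g i) (u, w) ∉ B i} + (s.card / 4 +
          ∑ i ∈ s, ∫⁻ w, ENNReal.ofReal (3 / 2 * A.energy f (g i) u n le_rfl w)
            ∂noiseLaw n)) := by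
        simp only [Finset.sum_add_distrib, Finset.sum_const, nsmul_eq_mul, mul_one_div]
    _ ≤ 1 + (∑ i ∈ s, noiseLaw n {w | A.output (f + g i) (u, w) ∉ B i} + (s.card / 4 +
          ENNReal.ofReal (3 / 2 * (η ^ 2 * n)))) := by gcongr
    _ = _ := by ring

/-- Many perturbations with disjoint supports cannot all be located: under one of them the
estimate misses the support with probability at least `1 / 3`. -/
lemma exists_one_third_le_seedNoiseLaw (hB : (s : Set ι).PairwiseDisjoint B)
    (hBm : ∀ i, MeasurableSet (B i))
    (hg0 : ∀ i ∈ s, ∀ x ∉ B i, g i x = 0) (hgη : ∀ i ∈ s, ∀ x, |g i x| ≤ η) {f : Pt d → ℝ}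
    (hf : Measurable f) (hg : ∀ i, Measurable (g i))
    (hs : 12 + 18 * (η ^ 2 * n) ≤ 5 * (s.card : ℝ)) (ν : Measure 𝒰) [IsProbabilityMeasure ν] :
    ∃ i ∈ s, (1 / 3 : ℝ≥0∞) ≤ seedNoiseLaw n ν {p | A.output (f + g i) p ∉ B i} := by
  have : IsProbabilityMeasure (seedNoiseLaw n ν) := by unfold seedNoiseLaw; infer_instance
  have hm : ∀ i, MeasurableSet {p | A.output (f + g i) p ∉ B i} := fun i =>
    (A.measurable_output (hf.add (hg i))) (hBm i).compl
  have hle : (s.card : ℝ≥0∞) ≤ ∑ i ∈ s, seedNoiseLaw n ν {p | A.output (f + g i) p ∉ B i} +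
      (1 + s.card / 4 + ENNReal.ofReal (3 / 2 * (η ^ 2 * n))) := by
    have hslice : ∀ i, Measurable fun u => noiseLaw n {w | A.output (f + g i) (u, w) ∉ B i} :=
      fun i => measurable_measure_prodMk_left (hm i)
    have hprod : ∀ i, seedNoiseLaw n ν {p | A.output (f + g i) p ∉ B i} =
        ∫⁻ u, noiseLaw n {w | A.output (f + g i) (u, w) ∉ B i} ∂ν := fun i =>
      Measure.prod_apply (hm i)
    simp only [hprod]
    rw [← lintegral_finsetSum _ fun i _ => hslice i]
    calc (s.card : ℝ≥0∞) = ∫⁻ _u, (s.card : ℝ≥0∞) ∂ν := by simp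
      _ ≤ _ := lintegral_mono fun u => A.card_le_sum_noiseLaw hB hBm hg0 hgη hf hg u
      _ = _ := by rw [lintegral_add_right _ measurable_const]; simp
  have hpos : 0 < (s.card : ℝ) := by
    have : 0 ≤ 18 * (η ^ 2 * n) := by positivity
    linarith
  have hne : s.Nonempty := Finset.card_pos.1 (by exact_mod_cast hpos)
  have hreal : (s.card : ℝ) ≤ ∑ i ∈ s, (seedNoiseLaw n ν {p | A.output (f + g i) p ∉ B i}).toReal +
      (1 + s.card / 4 + 3 / 2 * (η ^ 2 * n)) := by
    have hfin : ∑ i ∈ s, seedNoiseLaw n ν {p | A.output (f + g i) p ∉ B i} ≠ ⊤ :=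
      ENNReal.sum_ne_top.2 fun i _ => measure_ne_top _ _
    have hfin2 : (1 + s.card / 4 : ℝ≥0∞) ≠ ⊤ :=
      ENNReal.add_ne_top.2 ⟨by simp, ENNReal.div_ne_top (by simp) (by simp)⟩
    have h := ENNReal.toReal_mono
      (ENNReal.add_ne_top.2 ⟨hfin, ENNReal.add_ne_top.2 ⟨hfin2, ENNReal.ofReal_ne_top⟩⟩) hle
    rw [ENNReal.toReal_add hfin (ENNReal.add_ne_top.2 ⟨hfin2, ENNReal.ofReal_ne_top⟩),
      ENNReal.toReal_add hfin2 ENNReal.ofReal_ne_top,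
      ENNReal.toReal_add (by simp) (ENNReal.div_ne_top (by simp) (by simp)),
      ENNReal.toReal_sum fun i _ => measure_ne_top _ _, ENNReal.toReal_ofReal (by positivity)] at h
    simpa using h
  obtain ⟨i, hi, hp⟩ := Finset.exists_le_of_sum_le hne
    (f := fun _ => (1 / 3 : ℝ))
    (g := fun i => (seedNoiseLaw n ν {p | A.output (f + g i) p ∉ B i}).toReal) (by
      rw [Finset.sum_const, nsmul_eq_mul]; linarith)
  refine ⟨i, hi, ?_⟩
  rw [← ENNReal.ofReal_le_iff_le_toReal (measure_ne_top _ _)] at hp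
  rwa [ENNReal.ofReal_div_of_pos (by norm_num), ENNReal.ofReal_one,
    ENNReal.ofReal_ofNat] at hp

end ActiveAlgorithm

/-! ### Level sets and the local rate -/

lemma nonempty_cube (d : ℕ) : (cube d).Nonempty :=
  (nonempty_interior_cube d).mono interior_subset

lemma minValue_le {f : Pt d → ℝ} (hf : BddBelow (f '' cube d)) {x : Pt d} (hx : x ∈ cube d) :
    minValue f ≤ f x := csInf_le hf ⟨x, hx, rfl⟩

lemma volume_levelSet_le_one (f : Pt d → ℝ) (ε : ℝ) : volume (levelSet f ε) ≤ 1 :=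
  (measure_mono fun _ hx => hx.1).trans_eq (volume_cube d)

lemma volume_levelSet_ne_top (f : Pt d → ℝ) (ε : ℝ) : volume (levelSet f ε) ≠ ⊤ :=
  ((volume_levelSet_le_one f ε).trans_lt ENNReal.one_lt_top).ne

lemma levelVolume_le_one (f : Pt d → ℝ) (ε : ℝ) : levelVolume f ε ≤ 1 :=
  ENNReal.toReal_mono ENNReal.one_ne_top (volume_levelSet_le_one f ε)

lemma levelVolume_pos {f : Pt d → ℝ} (hf : ContinuousOn f (cube d)) {ε : ℝ} (hε : 0 < ε) :
    0 < levelVolume f ε := by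
  obtain ⟨_, ⟨x, hx, rfl⟩, hlt⟩ := exists_lt_of_csInf_lt ((nonempty_cube d).image f)
    (lt_add_of_pos_right (minValue f) hε)
  exact ENNReal.toReal_pos (volume_pos_of_continuousOn hf hx hlt).ne' (volume_levelSet_ne_top f ε)

lemma lowerRate_nonneg (α : ℝ) (n : ℕ) (f : Pt d → ℝ) : 0 ≤ lowerRate α n f :=
  Real.sSup_nonneg fun _ h => h.1.le

lemma le_of_mem_lowerRate_set {α : ℝ} (hα : 0 < α) (hn : 1 ≤ n) (f : Pt d → ℝ) {e : ℝ}
    (he : 0 < e ∧ (n : ℝ) ≤ e ^ (-(2 + (d : ℝ) / α)) * levelVolume f e) :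
    e ≤ (n : ℝ)⁻¹ ^ (2 + (d : ℝ) / α)⁻¹ := by
  have hp : 0 < 2 + (d : ℝ) / α := by positivity
  have hn' : (0 : ℝ) < n := by exact_mod_cast hn
  obtain ⟨he0, he⟩ := he
  rw [Real.le_rpow_inv_iff_of_pos he0.le (by positivity) hp,
    le_inv_comm₀ (Real.rpow_pos_of_pos he0 _) hn', ← Real.rpow_neg he0.le]
  exact he.trans (mul_le_of_le_one_right (Real.rpow_nonneg he0.le _) (levelVolume_le_one f e))

lemma lowerRate_rpow_le {α : ℝ} (hα : 0 < α) (hn : 1 ≤ n) (f : Pt d → ℝ) :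
    lowerRate α n f ^ (2 + (d : ℝ) / α) ≤ (n : ℝ)⁻¹ := by
  rw [← Real.le_rpow_inv_iff_of_pos (lowerRate_nonneg _ _ _) (by positivity) (by positivity)]
  exact Real.sSup_le (fun e he => le_of_mem_lowerRate_set hα hn f he) (by positivity)

/-- A lower bound on the packing number is witnessed, up to an arbitrarily small loss, by a finite
packing; the packing number itself could be infinite. -/
lemma exists_packing {S : Set (Pt d)} {δ a b : ℝ} (hb : b < a)
    (h : ENNReal.ofReal a ≤ ((ballPackingNumber S δ : ℕ∞) : ℝ≥0∞)) :
    ∃ s : Finset (Pt d), (∀ x ∈ s, Metric.closedBall x δ ⊆ S) ∧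
      ((s : Set (Pt d)).PairwiseDisjoint fun x => Metric.closedBall x δ) ∧ b < s.card := by
  by_contra! hcon
  rcases lt_or_ge b 0 with hb0 | hb0
  · have := hcon ∅ (by simp) (by simp)
    simp at this
    linarith
  have hle : ballPackingNumber S δ ≤ (⌊b⌋₊ : ℕ∞) :=
    iSup₂_le fun s hs => by exact_mod_cast Nat.le_floor (hcon s hs.1 hs.2)
  have h2 : ENNReal.ofReal a ≤ (⌊b⌋₊ : ℝ≥0∞) := by
    refine h.trans ?_
    have := ENat.toENNReal_le.2 hle
    simpa using this
  rw [ENNReal.ofReal_le_natCast] at h2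
  linarith [Nat.floor_le hb0]

/-- A level set of a function with the packing property contains a ball of the maximal radius
`c₀'`; this bounds its volume from below, uniformly in the level. -/
lemma volume_closedBall_le_levelVolume {c₀' C₀' : ℝ} (hc₀' : 0 < c₀') (hC₀' : 0 < C₀')
    {f : Pt d → ℝ} (hf : ContinuousOn f (cube d)) (hfP : f ∈ PackedLevelSets d c₀' C₀') {ε : ℝ}
    (hε : ε ∈ Set.Ioc 0 c₀') :
    (volume (Metric.closedBall (0 : Pt d) c₀')).toReal ≤ levelVolume f ε := by
  have hμ := levelVolume_pos hf hε.1
  have hpos : 0 < C₀' * levelVolume f ε * (c₀' ^ d)⁻¹ := by positivity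
  obtain ⟨s, hs, -, hcard⟩ := exists_packing hpos (hfP ε hε c₀' ⟨hc₀', le_rfl⟩)
  obtain ⟨x, hx⟩ := Finset.card_pos.1 (by exact_mod_cast hcard : 0 < s.card)
  rw [← Measure.addHaar_closedBall_center volume x]
  exact ENNReal.toReal_mono (volume_levelSet_ne_top f ε) (measure_mono (hs x hx))

lemma lowerRate_pos {α c₀' C₀' : ℝ} (hα : 0 < α) (hn : 1 ≤ n) (hc₀' : 0 < c₀') (hC₀' : 0 < C₀')
    {f : Pt d → ℝ} (hf : ContinuousOn f (cube d)) (hfP : f ∈ PackedLevelSets d c₀' C₀') :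
    0 < lowerRate α n f := by
  have hp : 0 < 2 + (d : ℝ) / α := by positivity
  have hn' : (0 : ℝ) < n := by exact_mod_cast hn
  set v := (volume (Metric.closedBall (0 : Pt d) c₀')).toReal
  have hv0 : 0 < v := ENNReal.toReal_pos (Metric.measure_closedBall_pos volume _ hc₀').ne'
    measure_closedBall_lt_top.ne
  -- At every level `e ≤ c₀'` with `e ^ (2 + d / α) ≤ v / n` the defining inequality holds.
  set e := min c₀' ((v / n) ^ (2 + (d : ℝ) / α)⁻¹)
  have he0 : 0 < e := lt_min hc₀' (by positivity)
  have hev : e ^ (2 + (d : ℝ) / α) ≤ v / n :=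
    (Real.le_rpow_inv_iff_of_pos he0.le (by positivity) hp).1 (min_le_right _ _)
  have hvol := volume_closedBall_le_levelVolume hc₀' hC₀' hf hfP ⟨he0, min_le_left _ _⟩
  refine he0.trans_le (le_csSup ⟨_, fun _ h => le_of_mem_lowerRate_set hα hn f h⟩ ⟨he0, ?_⟩)
  rw [Real.rpow_neg he0.le, ← div_eq_inv_mul, le_div_iff₀ (Real.rpow_pos_of_pos he0 _)]
  rw [le_div_iff₀ hn'] at hev
  linarith

lemma exists_packing_levelSet {c₀' C₀' : ℝ} (hc₀' : 0 < c₀') (hC₀' : 0 < C₀') {f : Pt d → ℝ}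
    (hf : ContinuousOn f (cube d)) (hfP : f ∈ PackedLevelSets d c₀' C₀') {ε δ b : ℝ} (hε : 0 < ε)
    (hδ : δ ∈ Set.Ioc 0 c₀')
    (hb : b < C₀' * (volume (Metric.closedBall (0 : Pt d) c₀')).toReal * (δ ^ d)⁻¹) :
    ∃ s : Finset (Pt d), (∀ x ∈ s, Metric.closedBall x δ ⊆ levelSet f ε) ∧
      ((s : Set (Pt d)).PairwiseDisjoint fun x => Metric.closedBall x δ) ∧ b < s.card := by
  -- The packing property concerns only levels up to `c₀'`.
  set e := min ε c₀'
  have hmem : e ∈ Set.Ioc 0 c₀' := ⟨lt_min hε hc₀', min_le_right _ _⟩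
  have hsub : levelSet f e ⊆ levelSet f ε := fun x hx =>
    ⟨hx.1, hx.2.trans (add_le_add le_rfl (min_le_left _ _))⟩
  have hball := volume_closedBall_le_levelVolume hc₀' hC₀' hf hfP hmem
  have hδ0 := hδ.1
  obtain ⟨s, hs, hdisj, hcard⟩ := exists_packing (b := b)
    (a := C₀' * levelVolume f e * (δ ^ d)⁻¹)
    (hb.trans_le (by gcongr)) (hfP e hmem δ hδ)
  exact ⟨s, fun x hx => (hs x hx).trans hsub, hdisj, hcard⟩

/-- A dip of depth `2 ε` around a point of the level set `L_f(ε)` lowers the minimum by at least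
`ε`, so that outside the dip the optimization error is at least `ε`. -/
lemma le_optError_of_notMem {f : Pt d → ℝ} {ε δ : ℝ} {c x : Pt d} (hδ : 0 < δ)
    (hf : BddBelow (f '' cube d))
    (hf' : BddBelow ((f + fun x => -(2 * ε) * scaledBump c δ x) '' cube d))
    (hc : c ∈ levelSet f ε) (hx : x ∈ cube d) (hxc : x ∉ Metric.closedBall c δ) :
    ε ≤ optError (f + fun x => -(2 * ε) * scaledBump c δ x) x := by
  have h1 := minValue_le hf' hc.1
  have h2 := minValue_le hf hx
  have h3 := hc.2
  unfold optError
  simp only [Pi.add_apply, scaledBump_self, scaledBump_eq_zero hδ hxc] at h1 ⊢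
  linarith

end ZerothOrder

open ZerothOrder

theorem theorem2 (d : ℕ) (hd : 1 ≤ d) (α c₀ C₀ c₀' C₀' : ℝ)
    (hα : 0 < α) (hc₀ : 0 < c₀) (hC₀ : 0 < C₀) (hc₀' : 0 < c₀') (hC₀' : 0 < C₀') :
    ∃ M : ℝ, 0 < M ∧
      ∀ f₀ : ZerothOrder.Pt d → ℝ,
        f₀ ∈ ZerothOrder.HolderClass d α (M / 2) →
        f₀ ∈ ZerothOrder.RegularLevelSets d c₀ C₀ →
        f₀ ∈ ZerothOrder.PackedLevelSets d c₀' C₀' →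
        ∀ n : ℕ, 1 ≤ n →
        ∀ (𝒰 : Type*) [MeasurableSpace 𝒰] (ν : MeasureTheory.Measure 𝒰)
          [MeasureTheory.IsProbabilityMeasure ν] (A : ZerothOrder.ActiveAlgorithm d n 𝒰),
          ∃ f ∈ ZerothOrder.HolderClass d α M,
            (∀ x ∈ ZerothOrder.cube d, |f x - f₀ x| ≤ 2 * ZerothOrder.lowerRate α n f₀) ∧
            (1 / 3 : ENNReal) ≤ ZerothOrder.seedNoiseLaw n ν
              {p | ZerothOrder.lowerRate α n f₀ ≤ ZerothOrder.optError f (A.output f p)} := by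
  obtain ⟨C, hC, hbump⟩ := exists_scaledBump_mem_holderClass d hα
  set v := (volume (Metric.closedBall (0 : Pt d) c₀')).toReal with hv
  have hv0 : 0 < v := ENNReal.toReal_pos (Metric.measure_closedBall_pos volume _ hc₀').ne'
    measure_closedBall_lt_top.ne
  -- The bumps have radius `r ε ^ (1 / α)`; a small `r` leaves room for many of them, at the price
  -- of a Hölder constant of order `r ^ (-α)`.
  set r := min 1 (min c₀' (C₀' * v / 40)) with hr
  have hr0 : 0 < r := lt_min one_pos (lt_min hc₀' (by positivity))
  have hr1 : r ≤ 1 := min_le_left _ _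
  have hrc : r ≤ c₀' := (min_le_right _ _).trans (min_le_left _ _)
  have hrv : 40 * r ≤ C₀' * v := by
    have : r ≤ C₀' * v / 40 := (min_le_right _ _).trans (min_le_right _ _)
    linarith
  refine ⟨4 * C * r ^ (-α), by positivity, fun f₀ hf₀ _ hfP n hn 𝒰 _ ν _ A => ?_⟩
  set M := 4 * C * r ^ (-α) with hM
  have hbdd := bddBelow_of_mem_holderClass hf₀
  have hcont := continuousOn_of_mem_holderClass hα hf₀
  set ε := lowerRate α n f₀
  have hrate : ε ^ (2 + (d : ℝ) / α) ≤ (n : ℝ)⁻¹ := lowerRate_rpow_le hα hn f₀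
  have hn0 : (0 : ℝ) < n := by exact_mod_cast hn
  have hε : 0 < ε := lowerRate_pos hα hn hc₀' hC₀' hcont hfP
  have hε1 : ε ≤ 1 := by
    have h1 : ε ^ (2 + (d : ℝ) / α) ≤ 1 :=
      hrate.trans (inv_le_one_of_one_le₀ (by exact_mod_cast hn))
    by_contra! hlt
    exact absurd h1 (not_le.2 (Real.one_lt_rpow hlt (by positivity)))
  set E := ε ^ (-((d : ℝ) / α)) with hE
  have hE1 : 1 ≤ E :=
    Real.one_le_rpow_of_pos_of_le_one_of_nonpos hε hε1 (neg_nonpos.2 (by positivity))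
  have hEn : ε ^ 2 * n ≤ E := by
    rw [Real.rpow_add hε, Real.rpow_two, ← one_div, le_div_iff₀ hn0] at hrate
    rw [hE, Real.rpow_neg hε.le, ← one_div, le_div_iff₀ (Real.rpow_pos_of_pos hε _)]
    linarith
  set δ := r * ε ^ (1 / α) with hδ
  have hεα : ε ^ (1 / α) ≤ 1 := Real.rpow_le_one hε.le hε1 (by positivity)
  have hδ0 : 0 < δ := by positivity
  have hδr : δ ≤ r := mul_le_of_le_one_right hr0.le hεα
  have hδd : (δ ^ d)⁻¹ = (r ^ d)⁻¹ * E := by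
    rw [hδ, mul_pow, mul_inv, hE, Real.rpow_neg hε.le, ← Real.rpow_natCast (ε ^ (1 / α)),
      ← Real.rpow_mul hε.le]
    congr 3
    ring
  obtain ⟨s, hs, hdisj, hcard⟩ := exists_packing_levelSet hc₀' hC₀' hcont hfP hε
    (δ := δ) (b := 20 * E) ⟨hδ0, hδr.trans hrc⟩ (by
      rw [hδd, ← hv, ← mul_assoc]
      refine mul_lt_mul_of_pos_right ?_ (by linarith)
      have h1 : r ^ d ≤ r := pow_le_of_le_one hr0.le hr1 (by omega)
      rw [← div_eq_mul_inv, lt_div_iff₀ (by positivity)]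
      linarith)
  have hg : ∀ c, (fun x => -(2 * ε) * scaledBump c δ x) ∈ HolderClass d α (M / 2) := by
    intro c
    have h := hbump (-(2 * ε)) c δ hδ0 (hδr.trans hr1)
    have heq : C * (|-(2 * ε)| * δ ^ (-α)) = M / 2 := by
      have : (ε ^ (1 / α)) ^ (-α) = ε⁻¹ := by
        rw [← Real.rpow_mul hε.le, mul_neg, one_div_mul_cancel hα.ne', Real.rpow_neg_one]
      rw [abs_neg, abs_of_pos (by positivity), hδ,
        Real.mul_rpow hr0.le (Real.rpow_nonneg hε.le _), this, hM]
      field_simp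
      ring
    rwa [heq] at h
  have habs : ∀ c x : Pt d, |-(2 * ε) * scaledBump c δ x| ≤ 2 * ε := by
    intro c x
    rw [abs_mul, abs_neg, abs_of_pos (by positivity : 0 < 2 * ε),
      abs_of_nonneg (scaledBump_nonneg _ _ _)]
    exact mul_le_of_le_one_right (by positivity) (scaledBump_le_one _ _ _)
  -- Only the values on the cube matter, and `f₀` need not be measurable outside it.
  classical
  set F := (cube d).piecewise f₀ 0 with hF
  have hFm : Measurable F :=
    hcont.measurable_piecewise continuousOn_const (isClosed_cube d).measurableSet
  obtain ⟨c, hc, hpr⟩ := A.exists_one_third_le_seedNoiseLaw (s := s)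
    (B := fun c => Metric.closedBall c δ) (g := fun c x => -(2 * ε) * scaledBump c δ x)
    (η := 2 * ε) hdisj (fun c => Metric.isClosed_closedBall.measurableSet)
    (fun c _ x hx => by rw [scaledBump_eq_zero hδ0 hx, mul_zero]) (fun c _ x => habs c x) hFm
    (fun c => ((continuous_scaledBump c δ).const_mul _).measurable) (by nlinarith) ν
  have hfM : (f₀ + fun x => -(2 * ε) * scaledBump c δ x) ∈ HolderClass d α M := by
    have := add_mem_holderClass hf₀ (hg c)
    rwa [add_halves] at this
  refine ⟨_, hfM, fun x _ => ?_, hpr.trans (measure_mono fun p hp => ?_)⟩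
  · rw [Pi.add_apply, add_sub_cancel_left]
    exact habs c x
  · have hout := A.output_congr (f := F + fun x => -(2 * ε) * scaledBump c δ x)
      (g := f₀ + fun x => -(2 * ε) * scaledBump c δ x) (fun x hx => by
        simp [hF, hx]) p
    rw [Set.mem_ofPred_eq, hout] at hp
    exact le_optError_of_notMem hδ0 hbdd (bddBelow_of_mem_holderClass hfM)
      (hs c hc (Metric.mem_closedBall_self hδ0.le)) (A.estimate_mem _) hp
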